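/- For $x,y\in\{0,1\}^n$ let $\mathrm{Hybrid}(x,y)$ be the set of $z\in\{0,1\}^n$ with $z_i=x_i$ for every index $i$ with $x_i=y_i$, and write $x\preceq y$ if $x_i\le y_i$ for all $i$. The bisection algorithm with at most $T$ initial draws does the following on $g\colon\{0,1\}^n\to\{0,1\}$. It draws pairs $x,y\in\{0,1\}^n$ uniformly and independently at random until $g(x)=0$ and $g(y)=1$; if $T$ pairs are drawn without satisfying this condition, it accepts. Then, while $|\mathrm{Hybrid}(x,y)|>2$, it draws $z\in\mathrm{Hybrid}(x,y)$ uniformly at random and replaces $x$ by $z$ if $g(z)=0$, and $y$ by $z$ if $g(z)=1$. Finally it accepts if $x\preceq y$ and rejects otherwise. A Talagrand DNF on $n$ variables is a function of the form $$f(x)=\bigvee_{j=1}^{2^{m}}\ \bigwedge_{a=1}^{m} x_{C_j(a)},\qquad m=\lfloor\sqrt n\rfloor,$$ for some maps $C_1,\dots,C_{2^m}\colon\{1,\dots,m\}\to\{1,\dots,n\}$ (that is, a possible value of Talagrand's random DNF, in which the $C_j$ are independent and uniformly random). For $S\subseteq\{1,\dots,n\}$ let $x^S$ denote $x$ with the variables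 in $S$ flipped. A function $g\colon\{0,1\}^n\to\{0,1\}$ is $\varepsilon$-far from monotone if every monotone function $h\colon\{0,1\}^n\to\{0,1\}$ differs from $g$ on at least $\varepsilon 2^n$ inputs. **Proposition.** There are absolute constants $\varepsilon>0$ and $K>0$ such that for every $n\ge 1$ there exist a Talagrand DNF $f$ on $n$ variables and a set $S\subseteq\{1,\dots,n\}$ for which the function $g(x)=f(x^S)$ is $\varepsilon$-far from monotone and yet, for every $T\ge 0$, the bisection algorithm with at most $T$ initial draws rejects $g$ with probability at most $K/\sqrt n$. -/

import Mathlib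

/-- The Boolean hypercube `{0,1}ⁿ`. It carries the coordinatewise order `x ⪯ y`
(with `false < true`), so that `Monotone f` is monotonicity on the hypercube. -/
abbrev Cube (n : ℕ) : Type := Fin n → Bool

/-- `f` is `ε`-far from monotone: every monotone Boolean function differs from `f` on at least
`ε 2ⁿ` inputs. -/
def FarFromMonotone {n : ℕ} (ε : ℝ) (f : Cube n → Bool) : Prop :=
  ∀ h : Cube n → Bool, Monotone h →
    ε * 2 ^ n ≤ ((Finset.univ.filter fun x => f x ≠ h x).card : ℝ)

/-- `x^S`: the input `x` with the variables in `S` flipped. -/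
def flipOn {n : ℕ} (S : Finset (Fin n)) (x : Cube n) : Cube n :=
  fun i => if i ∈ S then !(x i) else x i

/-- The Talagrand DNF determined by a sequence of `2 ^ ⌊√n⌋` clauses, the `j`-th of them being
the conjunction of the variables `C j a` for `a < ⌊√n⌋`. Talagrand's random DNF is the one with
`C` uniformly random. -/
def talagrandDNF {n : ℕ} (C : Fin (2 ^ Nat.sqrt n) → Fin (Nat.sqrt n) → Fin n) :
    Cube n → Bool :=
  fun x => decide (∃ j, ∀ a, x (C j a) = true)

/-- The inputs `z` that agree with `x` at every index where `x` and `y` agree. -/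
def hybrid {n : ℕ} (x y : Cube n) : Finset (Cube n) :=
  Finset.univ.filter fun z => ∀ i, x i = y i → z i = x i

theorem hybrid_nonempty {n : ℕ} (x y : Cube n) : (hybrid x y).Nonempty :=
  ⟨x, by simp [hybrid]⟩

/-- One iteration of the loop: draw `z` uniformly from `hybrid x y`; if `f z = 0` replace `x`
by `z`, and if `f z = 1` replace `y` by `z`. -/
noncomputable def bisectionStep {n : ℕ} (f : Cube n → Bool) (p : Cube n × Cube n) :
    PMF (Cube n × Cube n) :=
  (PMF.uniformOfFinset (hybrid p.1 p.2) (hybrid_nonempty p.1 p.2)).map fun z =>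
    if f z = true then (p.1, z) else (z, p.2)

/-- The loop `while |hybrid x y| > 2` followed by the verdict (accept if and only if
`x ⪯ y`), run
for at most `k` iterations. The outcome is `some true` for acceptance, `some false` for rejection,
and `none` if the loop condition still holds after `k` iterations. -/
noncomputable def bisectionLoop {n : ℕ} (f : Cube n → Bool) :
    ℕ → Cube n × Cube n → PMF (Option Bool)
  | 0, p => if 2 < (hybrid p.1 p.2).card then PMF.pure none
      else PMF.pure (some (decide (∀ i, p.1 i ≤ p.2 i)))
  | k + 1, p => if 2 < (hybrid p.1 p.2).card then (bisectionStep f p).bind (bisectionLoop f k)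
      else PMF.pure (some (decide (∀ i, p.1 i ≤ p.2 i)))

/-- The bisection algorithm on `f`, with its loop run for at most `k` iterations: draw
`x, y` uniformly and independently until `f x = 0` and `f y = 1`, accepting if `T` pairs have been
drawn without success; then run the loop from `(x, y)`. -/
noncomputable def bisectionAlgorithm {n : ℕ} (f : Cube n → Bool) (k : ℕ) :
    ℕ → PMF (Option Bool)
  | 0 => PMF.pure (some true)
  | T + 1 => (PMF.uniformOfFintype (Cube n × Cube n)).bind fun p =>
      if f p.1 = false ∧ f p.2 = true then bisectionLoop f k p else bisectionAlgorithm f k T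

/-- The probability that the bisection algorithm, drawing at most `T` initial pairs, rejects `f`:
the supremum (equivalently, the increasing limit) over `k` of the probability that it rejects
within `k` iterations of the loop. -/
noncomputable def bisectionRejectProb {n : ℕ} (f : Cube n → Bool) (T : ℕ) : ENNReal :=
  ⨆ k : ℕ, bisectionAlgorithm f k T (some false)

/-!
Let `f` be a Talagrand DNF and `m = ⌊√n⌋`. Flipping the variables of `S` maps `hybrid x y` onto
`hybrid x^S y^S`, so the run of the bisection algorithm on `g x = f (x^S)` is the flipped run on
`f`. The latter ends at an edge of the cube along which the monotone function `f` increases; the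
flipped edge is decreasing exactly when the direction of the edge lies in `S`. Hence for disjoint
sets `S` the rejection probabilities sum to at most `1`
(`sum_iSup_bisectionRejectProb_le_one`), and for `m` disjoint sets of `m` variables they are at
most `1 / m` on average, whatever the clauses of `f`.

On the other hand, fix a set `S` of `m` variables and let the clauses be random. A typical point
`y` of the cube has `n / 2 + O(√n)` ones. Given such a point, with probability bounded below there
is exactly one clause not falsified by the variables outside `S`, and that clause contains exactly
one variable `x_i` of `S` (`card_isolatesVariable`, `isolation_estimate`). Then `f` equals `x_i`
and `g` equals `¬ x_i` on the subcube through `y` in the directions of `S`, and a monotone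
function differs from `g` on at least half of this subcube
(`farFromMonotone_of_isolatesVariable`).

Averaging a suitable linear combination of the two quantities over the clauses and over `m`
disjoint sets `S` gives a choice for which both bounds hold
(`exists_isolated_and_bisectionRejectProb_le`).
-/

/-! ### Bisection commutes with flipping variables -/

theorem flipOn_involutive {n : ℕ} (S : Finset (Fin n)) : Function.Involutive (flipOn S) := by
  intro x
  funext i
  by_cases h : i ∈ S <;> simp [flipOn, h]

theorem flipOn_mem_hybrid_flipOn {n : ℕ} (S : Finset (Fin n)) (x y z : Cube n) :
    flipOn S z ∈ hybrid (flipOn S x) (flipOn S y) ↔ z ∈ hybrid x y := by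
  simp only [hybrid, Finset.mem_filter, Finset.mem_univ, true_and]
  refine forall_congr' fun i => ?_
  by_cases h : i ∈ S <;> simp [flipOn, h]

theorem sum_hybrid_flipOn {n : ℕ} (S : Finset (Fin n)) (x y : Cube n) (F : Cube n → ENNReal) :
    ∑ z ∈ hybrid (flipOn S x) (flipOn S y), F z = ∑ z ∈ hybrid x y, F (flipOn S z) := by
  refine (Finset.sum_bij' (fun z _ => flipOn S z) (fun z _ => flipOn S z)
    (fun z hz => (flipOn_mem_hybrid_flipOn S x y z).2 hz) (fun z hz => ?_)
    (fun z _ => flipOn_involutive S z) (fun z _ => flipOn_involutive S z) (fun z _ => rfl)).symm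
  rwa [← flipOn_mem_hybrid_flipOn S, flipOn_involutive S z]

theorem card_hybrid_flipOn {n : ℕ} (S : Finset (Fin n)) (x y : Cube n) :
    (hybrid (flipOn S x) (flipOn S y)).card = (hybrid x y).card := by
  have h := sum_hybrid_flipOn S x y fun _ => 1
  simpa using h

theorem bisectionLoop_succ_apply {n : ℕ} (f : Cube n → Bool) (k : ℕ) (p : Cube n × Cube n)
    (hp : 2 < (hybrid p.1 p.2).card) (o : Option Bool) :
    bisectionLoop f (k + 1) p o = ∑ z ∈ hybrid p.1 p.2, ((hybrid p.1 p.2).card : ENNReal)⁻¹ *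
      bisectionLoop f k (if f z = true then (p.1, z) else (z, p.2)) o := by
  rw [bisectionLoop, if_pos hp, bisectionStep, PMF.bind_map, PMF.bind_apply,
    tsum_eq_sum (s := hybrid p.1 p.2)]
  · refine Finset.sum_congr rfl fun z hz => ?_
    rw [PMF.uniformOfFinset_apply_of_mem _ hz, Function.comp_apply]
  · intro z hz
    rw [PMF.uniformOfFinset_apply_of_notMem _ hz, zero_mul]

theorem bisectionLoop_apply_of_card_le {n : ℕ} (f : Cube n → Bool) (k : ℕ) (p : Cube n × Cube n)
    (hp : (hybrid p.1 p.2).card ≤ 2) :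
    bisectionLoop f k p (some false) = if ∀ i, p.1 i ≤ p.2 i then 0 else 1 := by
  cases k <;> rw [bisectionLoop, if_neg hp.not_gt, PMF.pure_apply] <;>
    by_cases h : ∀ i, p.1 i ≤ p.2 i <;> simp only [h, decide_false] <;> simp

/-- The loop on `f (x^S)` is the loop on `f` conjugated by the flip of `S`: here the draws are
made in `hybrid x y` rather than in its flipped copy. -/
theorem bisectionLoop_succ_flipOn {n : ℕ} (f : Cube n → Bool) (S : Finset (Fin n)) (k : ℕ)
    (x y : Cube n) (hp : 2 < (hybrid x y).card) (o : Option Bool) :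
    bisectionLoop (fun x => f (flipOn S x)) (k + 1) (flipOn S x, flipOn S y) o =
      ∑ z ∈ hybrid x y, ((hybrid x y).card : ENNReal)⁻¹ *
        bisectionLoop (fun x => f (flipOn S x)) k
          (if f z = true then (flipOn S x, flipOn S z) else (flipOn S z, flipOn S y)) o := by
  rw [bisectionLoop_succ_apply _ _ _ (by simpa only [card_hybrid_flipOn] using hp)]
  simp only [card_hybrid_flipOn, sum_hybrid_flipOn]
  refine Finset.sum_congr rfl fun z _ => ?_
  rw [flipOn_involutive S z]

theorem bisectionAlgorithm_succ_apply {n : ℕ} (f : Cube n → Bool) (k T : ℕ) (o : Option Bool) :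
    bisectionAlgorithm f k (T + 1) o =
      ∑ p : Cube n × Cube n, (Fintype.card (Cube n × Cube n) : ENNReal)⁻¹ *
        if f p.1 = false ∧ f p.2 = true then bisectionLoop f k p o
          else bisectionAlgorithm f k T o := by
  rw [bisectionAlgorithm, PMF.bind_apply, tsum_fintype]
  refine Finset.sum_congr rfl fun p _ => ?_
  rw [PMF.uniformOfFintype_apply]
  split_ifs <;> rfl

theorem bisectionAlgorithm_succ_flipOn {n : ℕ} (f : Cube n → Bool) (S : Finset (Fin n)) (k T : ℕ)
    (o : Option Bool) :
    bisectionAlgorithm (fun x => f (flipOn S x)) k (T + 1) o =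
      ∑ p : Cube n × Cube n, (Fintype.card (Cube n × Cube n) : ENNReal)⁻¹ *
        if f p.1 = false ∧ f p.2 = true then
          bisectionLoop (fun x => f (flipOn S x)) k (flipOn S p.1, flipOn S p.2) o
        else bisectionAlgorithm (fun x => f (flipOn S x)) k T o := by
  rw [bisectionAlgorithm_succ_apply]
  let e : Cube n ≃ Cube n := (flipOn_involutive S).toPerm
  rw [← (e.prodCongr e).sum_comp]
  refine Finset.sum_congr rfl fun p _ => ?_
  change _ * (if f (flipOn S (flipOn S p.1)) = false ∧ f (flipOn S (flipOn S p.2)) = true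
    then bisectionLoop _ k (flipOn S p.1, flipOn S p.2) o else _) = _
  rw [flipOn_involutive S p.1, flipOn_involutive S p.2]

/-! ### Rejection by bisection along disjoint sets of variables -/

/-- Two distinct points whose hybrid has at most two elements span an edge of the cube. -/
theorem eq_of_ne_of_card_hybrid_le_two {n : ℕ} {x y : Cube n} (h : (hybrid x y).card ≤ 2)
    {i j : Fin n} (hi : x i ≠ y i) (hj : x j ≠ y j) : i = j := by
  by_contra hij
  have hsub : ({x, y, Function.update x i (y i)} : Finset (Cube n)) ⊆ hybrid x y := by
    intro z hz
    simp only [Finset.mem_insert, Finset.mem_singleton] at hz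
    simp only [hybrid, Finset.mem_filter, Finset.mem_univ, true_and]
    rintro l hl
    rcases hz with rfl | rfl | rfl
    · rfl
    · exact hl.symm
    · exact Function.update_of_ne (by rintro rfl; exact hi hl) _ _
  have hxy : x ≠ y := fun e => hi (congrFun e i)
  have hxu : x ≠ Function.update x i (y i) := fun e => hi (by simpa using congrFun e i)
  have hyu : y ≠ Function.update x i (y i) := fun e => hj (by
    simpa [Function.update_of_ne (Ne.symm hij)] using (congrFun e j).symm)
  have := (Finset.card_le_card hsub).trans h
  rw [Finset.card_eq_three.2 ⟨_, _, _, hxy, hxu, hyu, rfl⟩] at this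
  omega

/-- If `f` is monotone and `(x, y)` is an edge with `f x = 0`, `f y = 1`, then flipping `S` puts
the edge in decreasing position only if `S` contains its direction, so only for one of several
disjoint sets `S`. -/
theorem sum_bisectionLoop_edge_le_one {n : ℕ} {ι : Type*} [Fintype ι] (S : ι → Finset (Fin n))
    (hS : Pairwise fun a b => Disjoint (S a) (S b)) (f : Cube n → Bool) (hf : Monotone f)
    (k : ℕ) (x y : Cube n) (hx : f x = false) (hy : f y = true)
    (hp : (hybrid x y).card ≤ 2) :
    ∑ b, bisectionLoop (fun x => f (flipOn (S b) x)) k (flipOn (S b) x, flipOn (S b) y)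
      (some false) ≤ 1 := by
  obtain ⟨i, hi⟩ : ∃ i, ¬ y i ≤ x i := by
    by_contra! h
    have := hf (show y ≤ x from h)
    rw [hx, hy] at this
    exact absurd this (by decide)
  have hne : x i ≠ y i := fun e => hi e.symm.le
  have key : ∀ b, i ∉ S b → bisectionLoop (fun x => f (flipOn (S b) x)) k
      (flipOn (S b) x, flipOn (S b) y) (some false) = 0 := by
    intro b hb
    rw [bisectionLoop_apply_of_card_le _ _ _ (by simpa only [card_hybrid_flipOn] using hp),
      if_pos]
    intro j
    by_cases hj : x j = y j
    · simp [flipOn, hj]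
    · obtain rfl := eq_of_ne_of_card_hybrid_le_two hp hne hj
      simpa [flipOn, hb] using (not_le.1 hi).le
  by_cases hex : ∃ b, i ∈ S b
  · obtain ⟨b, hb⟩ := hex
    rw [Finset.sum_eq_single b]
    · exact PMF.coe_le_one _ _
    · intro c _ hc
      exact key c fun h => Finset.disjoint_left.1 (hS hc) h hb
    · simp
  · push Not at hex
    rw [Finset.sum_eq_zero fun b _ => key b (hex b)]
    exact zero_le_one

/-- Every iteration draws the same `z` for all the sets `S b` after undoing the flips, so the
bound for edges propagates by averaging over `z`. -/
theorem sum_bisectionLoop_le_one {n : ℕ} {ι : Type*} [Fintype ι] (S : ι → Finset (Fin n))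
    (hS : Pairwise fun a b => Disjoint (S a) (S b)) (f : Cube n → Bool) (hf : Monotone f)
    (k : ℕ) : ∀ x y : Cube n, f x = false → f y = true →
    ∑ b, bisectionLoop (fun x => f (flipOn (S b) x)) k (flipOn (S b) x, flipOn (S b) y)
      (some false) ≤ 1 := by
  induction k with
  | zero =>
    intro x y hx hy
    by_cases hp : 2 < (hybrid x y).card
    · refine (Finset.sum_eq_zero fun b _ => ?_).trans_le zero_le_one
      rw [bisectionLoop, if_pos (by simpa only [card_hybrid_flipOn] using hp), PMF.pure_apply,
        if_neg (by simp)]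
    · exact sum_bisectionLoop_edge_le_one S hS f hf 0 x y hx hy (not_lt.1 hp)
  | succ k ih =>
    intro x y hx hy
    by_cases hp : 2 < (hybrid x y).card
    · simp only [bisectionLoop_succ_flipOn _ _ _ _ _ hp]
      rw [Finset.sum_comm]
      simp only [← Finset.mul_sum]
      refine (mul_le_mul_right (Finset.sum_le_card_nsmul _ _ 1 fun z _ => ?_) _).trans ?_
      · by_cases hz : f z = true
        · simpa only [hz, if_true] using ih x z hx hz
        · simpa only [hz, if_false, Bool.false_eq_true] using ih z y (by simpa using hz) hy
      · rw [nsmul_one]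
        exact ENNReal.inv_mul_le_one _
    · exact sum_bisectionLoop_edge_le_one S hS f hf _ x y hx hy (not_lt.1 hp)

theorem sum_bisectionAlgorithm_le_one {n : ℕ} {ι : Type*} [Fintype ι] (S : ι → Finset (Fin n))
    (hS : Pairwise fun a b => Disjoint (S a) (S b)) (f : Cube n → Bool) (hf : Monotone f)
    (k T : ℕ) :
    ∑ b, bisectionAlgorithm (fun x => f (flipOn (S b) x)) k T (some false) ≤ 1 := by
  induction T with
  | zero => simp [bisectionAlgorithm]
  | succ T ih =>
    simp only [bisectionAlgorithm_succ_flipOn]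
    rw [Finset.sum_comm]
    simp only [← Finset.mul_sum]
    refine (mul_le_mul_right (Finset.sum_le_card_nsmul _ _ 1 fun p _ => ?_) _).trans ?_
    · by_cases hp : f p.1 = false ∧ f p.2 = true
      · simpa only [if_pos hp] using sum_bisectionLoop_le_one S hS f hf k p.1 p.2 hp.1 hp.2
      · simpa only [if_neg hp] using ih
    · rw [nsmul_one]
      exact ENNReal.inv_mul_le_one _

theorem bisectionLoop_le_succ {n : ℕ} (f : Cube n → Bool) (k : ℕ) :
    ∀ p, bisectionLoop f k p (some false) ≤ bisectionLoop f (k + 1) p (some false) := by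
  induction k with
  | zero =>
    intro p
    by_cases hp : 2 < (hybrid p.1 p.2).card
    · rw [bisectionLoop, if_pos hp, PMF.pure_apply, if_neg (by simp)]
      exact zero_le
    · rw [bisectionLoop_apply_of_card_le _ _ _ (not_lt.1 hp),
        bisectionLoop_apply_of_card_le _ _ _ (not_lt.1 hp)]
  | succ k ih =>
    intro p
    by_cases hp : 2 < (hybrid p.1 p.2).card
    · rw [bisectionLoop_succ_apply _ _ _ hp, bisectionLoop_succ_apply _ _ _ hp]
      exact Finset.sum_le_sum fun z _ => mul_le_mul_right (ih _) _
    · rw [bisectionLoop_apply_of_card_le _ _ _ (not_lt.1 hp),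
        bisectionLoop_apply_of_card_le _ _ _ (not_lt.1 hp)]

theorem bisectionAlgorithm_mono_left {n : ℕ} (f : Cube n → Bool) (T : ℕ) :
    Monotone fun k => bisectionAlgorithm f k T (some false) := by
  refine monotone_nat_of_le_succ fun k => ?_
  induction T with
  | zero => simp [bisectionAlgorithm]
  | succ T ih =>
    rw [bisectionAlgorithm_succ_apply, bisectionAlgorithm_succ_apply]
    refine Finset.sum_le_sum fun p _ => mul_le_mul_right ?_ _
    split_ifs
    exacts [bisectionLoop_le_succ f k p, ih]

theorem bisectionAlgorithm_mono_right {n : ℕ} (f : Cube n → Bool) (k : ℕ) :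
    Monotone fun T => bisectionAlgorithm f k T (some false) := by
  refine monotone_nat_of_le_succ fun T => ?_
  induction T with
  | zero => simp [bisectionAlgorithm]
  | succ T ih =>
    rw [bisectionAlgorithm_succ_apply, bisectionAlgorithm_succ_apply f k (T + 1)]
    refine Finset.sum_le_sum fun p _ => mul_le_mul_right ?_ _
    split_ifs
    exacts [le_rfl, ih]

theorem bisectionRejectProb_le_one {n : ℕ} (f : Cube n → Bool) (T : ℕ) :
    bisectionRejectProb f T ≤ 1 :=
  iSup_le fun _ => PMF.coe_le_one _ _

/-- Flipping disjoint sets of variables of a monotone function gives functions whose rejection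
probabilities sum to at most `1`: on `f`, bisection ends at an edge in one direction only. -/
theorem sum_iSup_bisectionRejectProb_le_one {n : ℕ} {ι : Type*} [Fintype ι]
    (S : ι → Finset (Fin n)) (hS : Pairwise fun a b => Disjoint (S a) (S b))
    (f : Cube n → Bool) (hf : Monotone f) :
    ∑ b, ⨆ T, bisectionRejectProb (fun x => f (flipOn (S b) x)) T ≤ 1 := by
  have hT : ∀ b, Monotone (bisectionRejectProb fun x => f (flipOn (S b) x)) := fun b T T' h =>
    iSup_mono fun k => bisectionAlgorithm_mono_right _ k h
  rw [ENNReal.finsetSum_iSup_of_monotone hT]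
  refine iSup_le fun T => ?_
  unfold bisectionRejectProb
  rw [ENNReal.finsetSum_iSup_of_monotone fun b => bisectionAlgorithm_mono_left _ T]
  exact iSup_le fun k => sum_bisectionAlgorithm_le_one S hS f hf k T

/-! ### Counting functions with exactly one exceptional value -/

theorem card_filter_exists_mem_forall_ne_mem {ι α : Type*} [Fintype ι] [DecidableEq ι] [Fintype α]
    [DecidableEq α] {P Q : Finset α} (h : Disjoint P Q) :
    (Finset.univ.filter fun c : ι → α => ∃ a, c a ∈ P ∧ ∀ b, b ≠ a → c b ∈ Q).card =
      Fintype.card ι * (P.card * Q.card ^ (Fintype.card ι - 1)) := by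
  have heq : (Finset.univ.filter fun c : ι → α => ∃ a, c a ∈ P ∧ ∀ b, b ≠ a → c b ∈ Q) =
      Finset.univ.biUnion fun a => Fintype.piFinset fun b => if b = a then P else Q := by
    ext c
    simp only [Finset.mem_filter, Finset.mem_univ, true_and, Finset.mem_biUnion,
      Fintype.mem_piFinset]
    refine exists_congr fun a => ⟨fun hc b => ?_, fun hc => ⟨by simpa using hc a, fun b hb => ?_⟩⟩
    · by_cases hb : b = a
      · subst hb; simpa using hc.1
      · simpa [hb] using hc.2 b hb
    · simpa [hb] using hc b
  rw [heq, Finset.card_biUnion]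
  · have : ∀ a : ι, (Fintype.piFinset fun b => if b = a then P else Q).card =
        P.card * Q.card ^ (Fintype.card ι - 1) := by
      intro a
      rw [Fintype.card_piFinset, ← Finset.mul_prod_erase _ _ (Finset.mem_univ a), if_pos rfl,
        Finset.prod_congr rfl (g := fun _ => Q.card) fun b hb => by
          rw [if_neg (Finset.ne_of_mem_erase hb)],
        Finset.prod_const, Finset.card_erase_of_mem (Finset.mem_univ a), Finset.card_univ]
    simp [this]
  · intro a _ a' _ haa'
    refine Finset.disjoint_left.2 fun c hc hc' => ?_
    have h1 := Fintype.mem_piFinset.1 hc a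
    have h2 := Fintype.mem_piFinset.1 hc' a
    rw [if_pos rfl] at h1
    rw [if_neg haa'] at h2
    exact Finset.disjoint_left.1 h h1 h2

/-! ### Concentration of the number of ones -/

theorem sum_sign_mul_sign {n : ℕ} (i j : Fin n) :
    ∑ y : Cube n, (if y i then (1 : ℝ) else -1) * (if y j then 1 else -1) =
      if i = j then 2 ^ n else 0 := by
  split_ifs with h
  · subst h
    rw [Finset.sum_congr rfl (g := fun _ => (1 : ℝ)) fun y _ => by split_ifs <;> norm_num]
    simp
  · -- flipping the variable `i` changes the sign of the summand
    let F : Cube n → ℝ := fun y => (if y i then (1 : ℝ) else -1) * (if y j then 1 else -1)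
    have hflip : ∀ y, F (flipOn {i} y) = -F y := by
      intro y
      have hj : flipOn {i} y j = y j := by simp [flipOn, Ne.symm h]
      have hi : flipOn {i} y i = !y i := by simp [flipOn]
      simp only [F]
      rw [hj, hi]
      cases y i <;> cases y j <;> simp
    have key : ∑ y, F (flipOn {i} y) = ∑ y, F y :=
      Equiv.sum_comp (flipOn_involutive ({i} : Finset (Fin n))).toPerm F
    rw [Finset.sum_congr rfl fun y _ => hflip y, Finset.sum_neg_distrib] at key
    change ∑ y, F y = 0
    linarith

theorem sum_sq_two_mul_card_sub (n : ℕ) :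
    ∑ y : Cube n, (2 * ((Finset.univ.filter fun i => y i = true).card : ℝ) - n) ^ 2 =
      (n : ℝ) * 2 ^ n := by
  have h : ∀ y : Cube n, 2 * ((Finset.univ.filter fun i => y i = true).card : ℝ) - n =
      ∑ i, if y i then (1 : ℝ) else -1 := by
    intro y
    have : ∀ i, (if y i then (1 : ℝ) else -1) = 2 * (if y i = true then 1 else 0) - 1 := by
      intro i; split_ifs <;> norm_num
    rw [Finset.sum_congr rfl fun i _ => this i, Finset.sum_sub_distrib, ← Finset.mul_sum,
      Finset.sum_boole]
    simp
  simp only [h, sq, Finset.sum_mul_sum]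
  rw [Finset.sum_comm]
  simp_rw [Finset.sum_comm (s := (Finset.univ : Finset (Cube n))), sum_sign_mul_sign]
  simp

/-- Chebyshev's inequality for the number of ones of a uniformly random point of the cube. -/
theorem three_mul_two_pow_le_card {n : ℕ} (hn : 1 ≤ n) :
    3 / 4 * (2 : ℝ) ^ n ≤ ((Finset.univ.filter fun y : Cube n =>
      (2 * ((Finset.univ.filter fun i => y i = true).card : ℝ) - n) ^ 2 ≤ 4 * n).card : ℝ) := by
  set A := Finset.univ.filter fun y : Cube n =>
      (2 * ((Finset.univ.filter fun i => y i = true).card : ℝ) - n) ^ 2 ≤ 4 * n with hA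
  have hn' : (0 : ℝ) < n := by exact_mod_cast hn
  have h1 : (Aᶜ.card : ℝ) * (4 * n) ≤ n * 2 ^ n := by
    rw [← sum_sq_two_mul_card_sub n, ← nsmul_eq_mul]
    refine (Finset.card_nsmul_le_sum _ _ _ fun y hy => ?_).trans
      (Finset.sum_le_sum_of_subset_of_nonneg (Finset.subset_univ Aᶜ) fun y _ _ => sq_nonneg _)
    simp only [hA, Finset.mem_compl, Finset.mem_filter, Finset.mem_univ, true_and, not_le] at hy
    exact hy.le
  have h2 : (A.card : ℝ) + Aᶜ.card = 2 ^ n := by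
    have := Finset.card_add_card_compl A
    simp only [Fintype.card_fun, Fintype.card_bool, Fintype.card_fin] at this
    exact_mod_cast this
  have h3 : (Aᶜ.card : ℝ) * 4 ≤ 2 ^ n := le_of_mul_le_mul_left (by linarith) hn'
  linarith

/-! ### Distance from monotonicity -/

/-- If `f` is a negated variable on each of disjoint lines of the cube, then every monotone
function errs on at least one point of each line. Here `U` is the union of the lines and `d x` is
the direction of the line through `x`. -/
theorem farFromMonotone_of_eq_not {n : ℕ} {ε : ℝ} {g : Cube n → Bool} (U : Finset (Cube n))
    (d : Cube n → Fin n) (hU : ∀ x ∈ U, flipOn {d x} x ∈ U ∧ d (flipOn {d x} x) = d x)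
    (hg : ∀ x ∈ U, g x = !(x (d x))) (hε : 2 * (ε * 2 ^ n) ≤ U.card) : FarFromMonotone ε g := by
  intro h hh
  set E := Finset.univ.filter fun x => g x ≠ h x
  let σ : Cube n → Cube n := fun x => flipOn {d x} x
  have hσσ : ∀ x ∈ U, σ (σ x) = x := by
    intro x hx
    change flipOn {d (flipOn {d x} x)} (flipOn {d x} x) = x
    rw [(hU x hx).2, flipOn_involutive]
  have hmem : ∀ x ∈ U, x ∈ E ∨ σ x ∈ E := by
    intro x hx
    simp only [E, Finset.mem_filter, Finset.mem_univ, true_and]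
    by_contra! hc
    have e1 := hg x hx
    have e2 := hg _ (hU x hx).1
    rw [(hU x hx).2] at e2
    have hd : flipOn {d x} x (d x) = !x (d x) := by simp [flipOn]
    rw [hd] at e2
    have hne : ∀ i, i ≠ d x → flipOn {d x} x i = x i := fun i hi => by simp [flipOn, hi]
    have h1 : h x = !x (d x) := hc.1.symm.trans e1
    have h2 : h (flipOn {d x} x) = !!x (d x) := hc.2.symm.trans e2
    cases hb : x (d x) with
    | false =>
      have hle : x ≤ flipOn {d x} x := fun i => by
        by_cases hi : i = d x
        · rw [hi, hb]; exact Bool.false_le _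
        · rw [hne i hi]
      have := hh hle
      rw [h1, h2, hb] at this
      exact absurd this (by decide)
    | true =>
      have hle : flipOn {d x} x ≤ x := fun i => by
        by_cases hi : i = d x
        · rw [hi, hb]; exact Bool.le_true _
        · rw [hne i hi]
      have := hh hle
      rw [h1, h2, hb] at this
      exact absurd this (by decide)
  have hcard : U.card ≤ E.card + E.card := by
    classical
    refine (Finset.card_le_card (t := E ∪ E.image σ) ?_).trans ?_
    · intro x hx
      rcases hmem x hx with h | h
      · exact Finset.mem_union_left _ h
      · exact Finset.mem_union_right _ (Finset.mem_image.2 ⟨σ x, h, hσσ x hx⟩)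
    · exact (Finset.card_union_le _ _).trans (Nat.add_le_add_left Finset.card_image_le _)
  have : (U.card : ℝ) ≤ E.card + E.card := by exact_mod_cast hcard
  linarith

/-! ### Subcubes on which a Talagrand DNF is a single variable -/

/-- The variables outside `S` that are set to `1` by `y`. -/
def onesOutside {n : ℕ} (S : Finset (Fin n)) (y : Cube n) : Finset (Fin n) :=
  Finset.univ.filter fun i => i ∉ S ∧ y i = true

theorem disjoint_onesOutside {n : ℕ} (S : Finset (Fin n)) (y : Cube n) :
    Disjoint S (onesOutside S y) :=
  Finset.disjoint_left.2 fun _ hi h => (Finset.mem_filter.1 h).2.1 hi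

theorem onesOutside_flipOn {n : ℕ} {S R : Finset (Fin n)} (h : R ⊆ S) (y : Cube n) :
    onesOutside S (flipOn R y) = onesOutside S y := by
  ext i
  simp only [onesOutside, Finset.mem_filter, Finset.mem_univ, true_and, and_congr_right_iff]
  intro hi
  have hR : i ∉ R := fun hR => hi (h hR)
  simp [flipOn, hR]

/-- One clause has exactly one occurrence of a variable of `S`, its other variables lying in `W`,
and every other clause has a variable outside `W ∪ S`. If `W` consists of the variables outside
`S` that are set to `1`, then all clauses but one are falsified outside `S`, and the remaining one
has become a variable of `S`. -/
def IsolatesVariable {ι κ : Type*} {n : ℕ} (C : ι → κ → Fin n) (S W : Finset (Fin n)) : Prop :=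
  ∃ j, (∃ a, C j a ∈ S ∧ ∀ b, b ≠ a → C j b ∈ W) ∧ ∀ j', j' ≠ j → ¬ ∀ a, C j' a ∈ W ∪ S

theorem IsolatesVariable.exists_talagrandDNF_eq {n : ℕ}
    {C : Fin (2 ^ Nat.sqrt n) → Fin (Nat.sqrt n) → Fin n} {S W : Finset (Fin n)}
    (h : IsolatesVariable C S W) :
    ∃ i ∈ S, ∀ y, onesOutside S y = W → talagrandDNF C y = y i := by
  obtain ⟨j, ⟨a, ha, hW⟩, hj⟩ := h
  refine ⟨C j a, ha, fun y hy => ?_⟩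
  rw [Bool.eq_iff_iff, talagrandDNF, decide_eq_true_iff]
  constructor
  · rintro ⟨j', hj'⟩
    by_cases e : j' = j
    · exact e ▸ hj' a
    · refine absurd (fun a => ?_) (hj j' e)
      rw [← hy, Finset.mem_union]
      by_cases hS : C j' a ∈ S
      · exact Or.inr hS
      · exact Or.inl (by simp [onesOutside, hS, hj' a])
  · intro h
    refine ⟨j, fun b => ?_⟩
    by_cases e : b = a
    · exact e ▸ h
    · have := hW b e
      rw [← hy] at this
      exact (Finset.mem_filter.1 this).2.2

open Classical in
theorem card_isolatesVariable {ι κ : Type*} [Fintype ι] [DecidableEq ι] [Fintype κ]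
    [DecidableEq κ] {n : ℕ}
    {S W : Finset (Fin n)} (h : Disjoint S W) :
    (Finset.univ.filter fun C : ι → κ → Fin n => IsolatesVariable C S W).card =
      Fintype.card ι * (Fintype.card κ * (S.card * W.card ^ (Fintype.card κ - 1)) *
        (n ^ Fintype.card κ - (W.card + S.card) ^ Fintype.card κ) ^ (Fintype.card ι - 1)) := by
  set P := Finset.univ.filter fun c : κ → Fin n => ∃ a, c a ∈ S ∧ ∀ b, b ≠ a → c b ∈ W with hP
  set B : Finset (κ → Fin n) := Fintype.piFinset fun _ => W ∪ S with hB
  have hdisj : Disjoint P Bᶜ := by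
    refine Finset.disjoint_left.2 fun c hc hc' => Finset.mem_compl.1 hc' ?_
    obtain ⟨a, ha, hW⟩ := (Finset.mem_filter.1 hc).2
    refine Fintype.mem_piFinset.2 fun b => ?_
    by_cases e : b = a
    · exact e ▸ Finset.mem_union_right _ ha
    · exact Finset.mem_union_left _ (hW b e)
  have h1 : P.card = _ := card_filter_exists_mem_forall_ne_mem h
  have h2 : Bᶜ.card = n ^ Fintype.card κ - (W.card + S.card) ^ Fintype.card κ := by
    rw [Finset.card_compl, hB, Fintype.card_piFinset, Finset.prod_const, Finset.card_univ,
      Finset.card_union_of_disjoint h.symm]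
    simp
  rw [← h1, ← h2, ← card_filter_exists_mem_forall_ne_mem hdisj]
  congr 1
  ext C
  simp [IsolatesVariable, hP, hB]

/-- If the variables of `S` are flipped, then the points where a variable is isolated witness the
distance from monotonicity. -/
theorem farFromMonotone_of_isolatesVariable {n : ℕ} {ε : ℝ}
    {C : Fin (2 ^ Nat.sqrt n) → Fin (Nat.sqrt n) → Fin n} {S : Finset (Fin n)}
    (U : Finset (Cube n)) (hU : ∀ y, y ∈ U ↔ IsolatesVariable C S (onesOutside S y))
    (hn : 1 ≤ n) (hε : 2 * (ε * 2 ^ n) ≤ U.card) :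
    FarFromMonotone ε fun x => talagrandDNF C (flipOn S x) := by
  have hex : ∀ W : Finset (Fin n), ∃ i, IsolatesVariable C S W →
      i ∈ S ∧ ∀ y, onesOutside S y = W → talagrandDNF C y = y i := by
    intro W
    by_cases h : IsolatesVariable C S W
    · obtain ⟨i, hi⟩ := h.exists_talagrandDNF_eq
      exact ⟨i, fun _ => hi⟩
    · exact ⟨⟨0, hn⟩, fun h' => absurd h' h⟩
  choose D hD using hex
  refine farFromMonotone_of_eq_not U (fun x => D (onesOutside S x)) (fun x hx => ?_)
    (fun x hx => ?_) hε
  · have hi := (hD _ ((hU x).1 hx)).1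
    have e := onesOutside_flipOn (Finset.singleton_subset_iff.2 hi) x
    refine ⟨?_, by rw [e]⟩
    rw [hU, e]
    exact (hU x).1 hx
  · obtain ⟨hi, h⟩ := hD _ ((hU x).1 hx)
    rw [h _ (onesOutside_flipOn subset_rfl x)]
    simp [flipOn, hi]

theorem monotone_talagrandDNF {n : ℕ} (C : Fin (2 ^ Nat.sqrt n) → Fin (Nat.sqrt n) → Fin n) :
    Monotone (talagrandDNF C) := by
  intro x y hxy
  refine Bool.le_iff_imp.2 fun h => ?_
  simp only [talagrandDNF, decide_eq_true_iff] at h ⊢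
  obtain ⟨j, hj⟩ := h
  exact ⟨j, fun a => Bool.le_iff_imp.1 (hxy (C j a)) (hj a)⟩

/-! ### Estimates for the expected number of isolated points -/

theorem exp_neg_two_mul_le_one_sub {q : ℝ} (h0 : 0 ≤ q) (h1 : q ≤ 1 / 2) :
    Real.exp (-(2 * q)) ≤ 1 - q := by
  rw [Real.exp_neg, inv_le_comm₀ (Real.exp_pos _) (by linarith)]
  refine le_trans ?_ (Real.add_one_le_exp (2 * q))
  rw [inv_le_iff_one_le_mul₀ (by linarith)]
  nlinarith

/-- Among `2 ^ m` independent uniformly random clauses, the probability that a variable is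
isolated is bounded below, when `S` has `m` elements and `w` of the variables outside `S` are set
to `1`. The right-hand side is the number of such choices of clauses, as in
`card_isolatesVariable`. The bound `64 ≤ n` makes `exp (-2 q) ≤ 1 - q` applicable both to
`q = 4 / √n` and to `q = exp 4 / 2 ^ m`. -/
theorem isolation_estimate {n m w : ℕ} (hn : 64 ≤ n) (hm : m = Nat.sqrt n)
    (hlow : (n : ℝ) / 2 - 2 * Real.sqrt n ≤ w)
    (hupp : (w : ℝ) + m ≤ n / 2 + 2 * Real.sqrt n) :
    1 / 2 * Real.exp (-8 - 2 * Real.exp 4) * (((n : ℝ) ^ m) ^ 2 ^ m) ≤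
      ((2 ^ m * (m * (m * w ^ (m - 1)) * (n ^ m - (w + m) ^ m) ^ (2 ^ m - 1)) : ℕ) : ℝ) := by
  have hn0 : (64 : ℝ) ≤ n := by exact_mod_cast hn
  set r := Real.sqrt n with hr
  have hrr : r * r = n := Real.mul_self_sqrt (by linarith)
  have hr8 : 8 ≤ r := Real.le_sqrt_of_sq_le (by linarith)
  have hm8 : 8 ≤ m := hm ▸ Nat.le_sqrt.2 (by omega)
  have hmr : (m : ℝ) ≤ r := by
    refine Real.le_sqrt_of_sq_le ?_
    have := Nat.sqrt_le' n
    rw [← hm] at this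
    exact_mod_cast this
  have hm4 : (n : ℝ) ≤ 4 * (m * m) := by
    have h2 := Nat.succ_le_succ_sqrt n
    rw [← hm] at h2
    have h3 : n ≤ 4 * (m * m) := by
      nlinarith
    exact_mod_cast h3
  have hm1 : m - 1 + 1 = m := by omega
  have hN : (0 : ℝ) < (n : ℝ) ^ m := by positivity
  -- the clauses that become a variable of `S`
  have hG : (1 / 2) * Real.exp (-8) * (n / 2) ^ m ≤ (m : ℝ) * (m * w ^ (m - 1)) := by
    have h1 : (n : ℝ) / 2 * Real.exp (-(8 / r)) ≤ w := by
      have h := exp_neg_two_mul_le_one_sub (q := 4 / r) (by positivity)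
        (by rw [div_le_iff₀ (by linarith)]; linarith)
      have e1 : 2 * (4 / r) = 8 / r := by ring
      rw [e1] at h
      refine le_trans (mul_le_mul_of_nonneg_left h (by positivity)) (le_trans (le_of_eq ?_) hlow)
      rw [← hrr]
      field_simp
      ring
    have h2 : (n / 2 : ℝ) ^ (m - 1) * Real.exp (-8) ≤ (w : ℝ) ^ (m - 1) := by
      refine le_trans ?_ (pow_le_pow_left₀ (by positivity) h1 _)
      rw [mul_pow, ← Real.exp_nat_mul]
      refine mul_le_mul_of_nonneg_left (Real.exp_le_exp.2 ?_) (by positivity)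
      have h3 : ((m - 1 : ℕ) : ℝ) ≤ r := le_trans (by exact_mod_cast Nat.sub_le _ _) hmr
      have h4 : ((m - 1 : ℕ) : ℝ) * (8 / r) ≤ 8 := by
        rw [mul_div_assoc', div_le_iff₀ (by linarith)]
        linarith
      linarith
    calc (1 / 2) * Real.exp (-8) * ((n : ℝ) / 2) ^ m
        = n / 4 * ((n / 2) ^ (m - 1) * Real.exp (-8)) := by
          conv_lhs => rw [← hm1, pow_succ]
          ring
      _ ≤ (m * m) * (w : ℝ) ^ (m - 1) := by
          refine mul_le_mul (by linarith) h2 (by positivity) (by positivity)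
      _ = _ := by ring
  -- the clauses that are not falsified outside `S`
  have hB : ((w : ℝ) + m) ^ m ≤ n ^ m * (Real.exp 4 / 2 ^ m) := by
    have h1 : (w : ℝ) + m ≤ n / 2 * Real.exp (4 / r) := by
      refine hupp.trans (le_trans (le_of_eq ?_)
        (mul_le_mul_of_nonneg_left (Real.add_one_le_exp (4 / r)) (by positivity)))
      rw [← hrr]
      field_simp
      ring
    refine (pow_le_pow_left₀ (by positivity) h1 m).trans ?_
    rw [mul_pow, ← Real.exp_nat_mul, div_pow, div_mul_eq_mul_div, mul_div_assoc]
    have h4 : (m : ℝ) * (4 / r) ≤ 4 := by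
      rw [mul_div_assoc', div_le_iff₀ (by linarith)]
      linarith
    exact mul_le_mul_of_nonneg_left
      (div_le_div_of_nonneg_right (Real.exp_le_exp.2 h4) (by positivity)) hN.le
  have hq : Real.exp 4 / 2 ^ m ≤ 1 / 2 := by
    have h1 : Real.exp 4 ≤ 128 := by
      have : Real.exp 4 = Real.exp 1 ^ 4 := by rw [← Real.exp_nat_mul]; norm_num
      rw [this]
      calc Real.exp 1 ^ 4 ≤ 3 ^ 4 := by
            gcongr
            exact Real.exp_one_lt_d9.le.trans (by norm_num)
        _ ≤ 128 := by norm_num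
    have h2 : (256 : ℝ) ≤ 2 ^ m := by
      calc (256 : ℝ) = 2 ^ 8 := by norm_num
        _ ≤ 2 ^ m := pow_le_pow_right₀ (by norm_num) hm8
    rw [div_le_iff₀ (by positivity)]
    linarith
  have hle : (w + m) ^ m ≤ n ^ m := by
    have : ((w : ℝ) + m) ^ m ≤ n ^ m :=
      hB.trans (mul_le_of_le_one_right hN.le (hq.trans (by norm_num)))
    exact_mod_cast this
  have hC : ((n : ℝ) ^ m) ^ (2 ^ m - 1) * Real.exp (-(2 * Real.exp 4)) ≤
      ((n : ℝ) ^ m - (w + m) ^ m) ^ (2 ^ m - 1) := by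
    have h1 : (n : ℝ) ^ m * Real.exp (-(2 * (Real.exp 4 / 2 ^ m))) ≤ (n : ℝ) ^ m - (w + m) ^ m := by
      have h := exp_neg_two_mul_le_one_sub (q := Real.exp 4 / 2 ^ m) (by positivity) hq
      have := mul_le_mul_of_nonneg_left h hN.le
      linarith
    refine le_trans ?_ (pow_le_pow_left₀ (by positivity) h1 _)
    rw [mul_pow ((n : ℝ) ^ m), ← Real.exp_nat_mul]
    refine mul_le_mul_of_nonneg_left (Real.exp_le_exp.2 ?_) (by positivity)
    have h3 : ((2 ^ m - 1 : ℕ) : ℝ) ≤ 2 ^ m := by exact_mod_cast Nat.sub_le _ _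
    have h4 : ((2 ^ m - 1 : ℕ) : ℝ) * (Real.exp 4 / 2 ^ m) ≤ Real.exp 4 := by
      rw [mul_div_assoc', div_le_iff₀ (by positivity), mul_comm]
      exact mul_le_mul_of_nonneg_left h3 (Real.exp_pos _).le
    linarith
  have h2m : 2 ^ m - 1 + 1 = 2 ^ m := Nat.sub_add_cancel Nat.one_le_two_pow
  push_cast [Nat.cast_sub hle]
  calc 1 / 2 * Real.exp (-8 - 2 * Real.exp 4) * (((n : ℝ) ^ m) ^ 2 ^ m)
      = 2 ^ m * ((1 / 2 * Real.exp (-8) * (n / 2) ^ m) *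
          (((n : ℝ) ^ m) ^ (2 ^ m - 1) * Real.exp (-(2 * Real.exp 4)))) := by
        conv_lhs => rw [← h2m, pow_succ, sub_eq_add_neg, Real.exp_add]
        rw [div_pow]
        field_simp
    _ ≤ _ := by
        refine mul_le_mul_of_nonneg_left ?_ (by positivity)
        exact mul_le_mul hG hC (by positivity) (by positivity)

open Classical in
/-- On average over the clauses, a constant proportion of the cube isolates a variable of `S`. -/
theorem le_sum_card_isolatesVariable {n : ℕ} (hn : 64 ≤ n) (S : Finset (Fin n))
    (hS : S.card = Nat.sqrt n) :
    3 / 8 * Real.exp (-8 - 2 * Real.exp 4) * 2 ^ n *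
        Fintype.card (Fin (2 ^ Nat.sqrt n) → Fin (Nat.sqrt n) → Fin n) ≤
      ∑ C : Fin (2 ^ Nat.sqrt n) → Fin (Nat.sqrt n) → Fin n,
        ((Finset.univ.filter fun y => IsolatesVariable C S (onesOutside S y)).card : ℝ) := by
  have hswap : ∑ C : Fin (2 ^ Nat.sqrt n) → Fin (Nat.sqrt n) → Fin n,
        ((Finset.univ.filter fun y => IsolatesVariable C S (onesOutside S y)).card : ℝ) =
      ∑ y : Cube n, ((Finset.univ.filter fun C : Fin (2 ^ Nat.sqrt n) → Fin (Nat.sqrt n) → Fin n =>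
        IsolatesVariable C S (onesOutside S y)).card : ℝ) := by
    exact_mod_cast Finset.sum_card_bipartiteAbove_eq_sum_card_bipartiteBelow
      (s := Finset.univ) (t := Finset.univ)
      fun (C : Fin (2 ^ Nat.sqrt n) → Fin (Nat.sqrt n) → Fin n) (y : Cube n) =>
        IsolatesVariable C S (onesOutside S y)
  rw [hswap]
  set A := Finset.univ.filter fun y : Cube n =>
      (2 * ((Finset.univ.filter fun i => y i = true).card : ℝ) - n) ^ 2 ≤ 4 * n with hA
  have hA' : 3 / 4 * (2 : ℝ) ^ n ≤ A.card := three_mul_two_pow_le_card (by omega)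
  refine le_trans ?_ (Finset.sum_le_sum_of_subset_of_nonneg (Finset.subset_univ A)
    fun _ _ _ => Nat.cast_nonneg _)
  have key : ∀ y ∈ A, 1 / 2 * Real.exp (-8 - 2 * Real.exp 4) *
      (((n : ℝ) ^ Nat.sqrt n) ^ 2 ^ Nat.sqrt n) ≤
      ((Finset.univ.filter fun C : Fin (2 ^ Nat.sqrt n) → Fin (Nat.sqrt n) → Fin n =>
        IsolatesVariable C S (onesOutside S y)).card : ℝ) := by
    intro y hy
    rw [card_isolatesVariable (disjoint_onesOutside S y), hS, Fintype.card_fin, Fintype.card_fin]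
    have hsq := (Finset.mem_filter.1 hy).2
    have hroot : |2 * ((Finset.univ.filter fun i => y i = true).card : ℝ) - n| ≤
        2 * Real.sqrt n := by
      refine abs_le_of_sq_le_sq ?_ (by positivity)
      rw [mul_pow, Real.sq_sqrt (Nat.cast_nonneg n)]
      linarith
    have hle : (onesOutside S y).card ≤ (Finset.univ.filter fun i => y i = true).card :=
      Finset.card_le_card fun i hi =>
        Finset.mem_filter.2 ⟨Finset.mem_univ _, (Finset.mem_filter.1 hi).2.2⟩
    have hge : (Finset.univ.filter fun i => y i = true).card ≤
        (onesOutside S y).card + Nat.sqrt n := by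
      rw [← hS]
      refine (Finset.card_le_card fun i hi => ?_).trans (Finset.card_union_le _ _)
      by_cases h : i ∈ S
      · exact Finset.mem_union_right _ h
      · exact Finset.mem_union_left _
          (Finset.mem_filter.2 ⟨Finset.mem_univ _, h, (Finset.mem_filter.1 hi).2⟩)
    have hle' : ((onesOutside S y).card : ℝ) ≤
      (Finset.univ.filter fun i => y i = true).card := by exact_mod_cast hle
    have hge' : ((Finset.univ.filter fun i => y i = true).card : ℝ) ≤
      (onesOutside S y).card + Nat.sqrt n := by exact_mod_cast hge
    have hmr : (Nat.sqrt n : ℝ) ≤ Real.sqrt n := Real.nat_sqrt_le_real_sqrt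
    rw [abs_le] at hroot
    exact isolation_estimate hn rfl (by linarith) (by linarith)
  have hcard : (Fintype.card (Fin (2 ^ Nat.sqrt n) → Fin (Nat.sqrt n) → Fin n) : ℝ) =
      ((n : ℝ) ^ Nat.sqrt n) ^ 2 ^ Nat.sqrt n := by
    simp
  refine le_trans ?_ (Finset.card_nsmul_le_sum _ _ _ key)
  rw [nsmul_eq_mul, hcard]
  have := mul_le_mul_of_nonneg_right hA' (show 0 ≤ 1 / 2 * Real.exp (-8 - 2 * Real.exp 4) *
      (((n : ℝ) ^ Nat.sqrt n) ^ 2 ^ Nat.sqrt n) by positivity)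
  linarith

/-! ### The choice of the clauses and of the flipped variables -/

theorem exists_disjoint_family_card_sqrt (n : ℕ) :
    ∃ S : Fin (Nat.sqrt n) → Finset (Fin n), (Pairwise fun a b => Disjoint (S a) (S b)) ∧
      ∀ b, (S b).card = Nat.sqrt n := by
  have hinj : Function.Injective fun p : Fin (Nat.sqrt n) × Fin (Nat.sqrt n) =>
      Fin.castLE (Nat.sqrt_le n) (finProdFinEquiv p) :=
    (Fin.castLE_injective _).comp finProdFinEquiv.injective
  refine ⟨fun b => Finset.univ.map ⟨_, hinj.comp (Prod.mk_right_injective b)⟩, ?_, by simp⟩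
  intro a b hab
  refine Finset.disjoint_left.2 fun i hi hi' => ?_
  obtain ⟨u, -, rfl⟩ := Finset.mem_map.1 hi
  obtain ⟨v, -, hv⟩ := Finset.mem_map.1 hi'
  exact hab (congrArg Prod.fst (hinj hv)).symm

open Classical in
/-- Averaging over the clauses and over `⌊√n⌋` disjoint sets of `⌊√n⌋` variables gives a choice
for which the isolated points are many, and so many as to pay for the rejection probability. -/
theorem exists_isolated_and_bisectionRejectProb_le {n : ℕ} (hn : 64 ≤ n) {c : ℝ} (hc0 : 0 ≤ c)
    (hc : c = 3 / 8 * Real.exp (-8 - 2 * Real.exp 4)) :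
    ∃ (C : Fin (2 ^ Nat.sqrt n) → Fin (Nat.sqrt n) → Fin n) (S : Finset (Fin n)),
      c / 2 + c / 2 * Nat.sqrt n *
          (⨆ T, bisectionRejectProb (fun x => talagrandDNF C (flipOn S x)) T).toReal ≤
        ((Finset.univ.filter fun y => IsolatesVariable C S (onesOutside S y)).card : ℝ) / 2 ^ n := by
  obtain ⟨S, hdisj, hcard⟩ := exists_disjoint_family_card_sqrt n
  have hm8 : 8 ≤ Nat.sqrt n := Nat.le_sqrt.2 (by omega)
  have : Nonempty (Fin n) := ⟨⟨0, by omega⟩⟩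
  have : Nonempty (Fin (Nat.sqrt n)) := ⟨⟨0, by omega⟩⟩
  let Ω := Fin (2 ^ Nat.sqrt n) → Fin (Nat.sqrt n) → Fin n
  let Q : Ω → Fin (Nat.sqrt n) → ℝ := fun C b =>
    (⨆ T, bisectionRejectProb (fun x => talagrandDNF C (flipOn (S b) x)) T).toReal
  have hQ : ∀ C, ∑ b, Q C b ≤ 1 := by
    intro C
    have hfin : ∀ b, (⨆ T, bisectionRejectProb (fun x => talagrandDNF C (flipOn (S b) x)) T) ≠ ⊤ :=
      fun b => ne_top_of_le_ne_top ENNReal.one_ne_top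
        (iSup_le fun T => bisectionRejectProb_le_one _ T)
    rw [← ENNReal.toReal_sum fun b _ => hfin b, ← ENNReal.toReal_one]
    exact ENNReal.toReal_mono ENNReal.one_ne_top
      (sum_iSup_bisectionRejectProb_le_one S hdisj _ (monotone_talagrandDNF C))
  have hsum : ∑ p : Fin (Nat.sqrt n) × Ω, (c / 2 + c / 2 * Nat.sqrt n * Q p.2 p.1) ≤
      ∑ p : Fin (Nat.sqrt n) × Ω, ((Finset.univ.filter fun y =>
        IsolatesVariable p.2 (S p.1) (onesOutside (S p.1) y)).card : ℝ) / 2 ^ n := by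
    have h1 : ∑ p : Fin (Nat.sqrt n) × Ω, (c / 2 + c / 2 * Nat.sqrt n * Q p.2 p.1) ≤
        Nat.sqrt n * (Fintype.card Ω * c) := by
      rw [Fintype.sum_prod_type_right]
      have : ∀ C : Ω, ∑ b, (c / 2 + c / 2 * Nat.sqrt n * Q C b) ≤ Nat.sqrt n * c := by
        intro C
        rw [Finset.sum_add_distrib, ← Finset.mul_sum, Finset.sum_const, Finset.card_univ,
          Fintype.card_fin, nsmul_eq_mul]
        have := mul_le_mul_of_nonneg_left (hQ C) (show 0 ≤ c / 2 * Nat.sqrt n by positivity)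
        linarith
      refine (Finset.sum_le_card_nsmul _ _ _ fun C _ => this C).trans (le_of_eq ?_)
      rw [nsmul_eq_mul, Finset.card_univ]
      ring
    refine h1.trans ?_
    rw [Fintype.sum_prod_type]
    refine le_trans (le_of_eq ?_) (Finset.card_nsmul_le_sum Finset.univ _ (Fintype.card Ω * c)
      fun b _ => ?_)
    · rw [nsmul_eq_mul, Finset.card_univ, Fintype.card_fin]
    · rw [← Finset.sum_div, le_div_iff₀ (by positivity)]
      have := le_sum_card_isolatesVariable hn (S b) (hcard b)
      rw [← hc] at this
      linarith
  obtain ⟨p, -, hp⟩ := Finset.exists_le_of_sum_le Finset.univ_nonempty hsum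
  exact ⟨p.2, S p.1, hp⟩

theorem farFromMonotone_not_apply {n : ℕ} (i : Fin n) :
    FarFromMonotone (1 / 2) fun x : Cube n => !(x i) := by
  refine farFromMonotone_of_eq_not Finset.univ (fun _ => i) (fun x _ => ⟨Finset.mem_univ _, rfl⟩)
    (fun x _ => rfl) (le_of_eq ?_)
  simp

theorem mainTheorem3 :
    ∃ ε : ℝ, 0 < ε ∧ ∃ K : ℝ, 0 < K ∧ ∀ n : ℕ, 1 ≤ n →
      ∃ (C : Fin (2 ^ Nat.sqrt n) → Fin (Nat.sqrt n) → Fin n) (S : Finset (Fin n))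
        (g : Cube n → Bool),
        (∀ x, g x = talagrandDNF C (flipOn S x)) ∧
        FarFromMonotone ε g ∧
        ∀ T : ℕ, bisectionRejectProb g T ≤ ENNReal.ofReal (K / Real.sqrt n) := by
  classical
  obtain ⟨c, hc⟩ : ∃ c, c = 3 / 8 * Real.exp (-8 - 2 * Real.exp 4) := ⟨_, rfl⟩
  have hc0 : 0 < c := by rw [hc]; positivity
  have hc1 : c ≤ 1 := by
    have : Real.exp (-8 - 2 * Real.exp 4) ≤ 1 :=
      Real.exp_le_one_iff.2 (by linarith [Real.exp_pos 4])
    rw [hc]; linarith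
  refine ⟨c / 4, by positivity, 4 / c + 8, by positivity, fun n hn => ?_⟩
  have hr0 : 0 < Real.sqrt n := Real.sqrt_pos.2 (by exact_mod_cast hn)
  by_cases hn64 : 64 ≤ n
  · obtain ⟨C, S, h⟩ := exists_isolated_and_bisectionRejectProb_le hn64 hc0.le hc
    refine ⟨C, S, fun x => talagrandDNF C (flipOn S x), fun _ => rfl, ?_, fun T => ?_⟩
    · refine farFromMonotone_of_isolatesVariable _ (fun y => by simp) hn
        (le_trans (le_of_eq (by ring)) ((le_div_iff₀ (by positivity)).1
          (le_trans (le_add_of_nonneg_right (by positivity)) h)))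
    · set Q := ⨆ T, bisectionRejectProb (fun x => talagrandDNF C (flipOn S x)) T with hQ
      have hQT : Q ≠ ⊤ := ne_top_of_le_ne_top ENNReal.one_ne_top
        (iSup_le fun T => bisectionRejectProb_le_one _ T)
      refine (le_iSup _ T).trans ((ENNReal.le_ofReal_iff_toReal_le hQT (by positivity)).2 ?_)
      have hle : c / 2 + c / 2 * Nat.sqrt n * Q.toReal ≤ 1 := by
        refine h.trans (div_le_one_of_le₀ ?_ (by positivity))
        have := Finset.card_le_univ
          (Finset.univ.filter fun y => IsolatesVariable C S (onesOutside S y))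
        rw [Fintype.card_fun, Fintype.card_bool, Fintype.card_fin] at this
        exact_mod_cast this
      have hrm : Real.sqrt n ≤ 2 * Nat.sqrt n := by
        have h1 : Real.sqrt n ≤ Nat.sqrt n + 1 := Real.real_sqrt_le_nat_sqrt_succ
        have h2 : (1 : ℝ) ≤ Nat.sqrt n := by exact_mod_cast Nat.le_sqrt.2 (by omega)
        linarith
      rw [le_div_iff₀ hr0]
      have h1 : Q.toReal * Real.sqrt n ≤ Q.toReal * (2 * Nat.sqrt n) :=
        mul_le_mul_of_nonneg_left hrm ENNReal.toReal_nonneg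
      have h2 : Q.toReal * (2 * Nat.sqrt n) ≤ 4 / c := by
        rw [le_div_iff₀ hc0]
        nlinarith
      linarith
  · -- For bounded `n` the probability bound is void, and a negated variable will do.
    let i : Fin n := ⟨0, hn⟩
    have hm : 0 < Nat.sqrt n := Nat.sqrt_pos.2 hn
    refine ⟨fun _ _ => i, {i}, fun x => !(x i), fun x => ?_, fun h hh => ?_, fun T => ?_⟩
    · change (!(x i)) = _
      have : (flipOn {i} x) i = !(x i) := by simp [flipOn]
      rw [← this, Bool.eq_iff_iff, talagrandDNF, decide_eq_true_iff]
      exact ⟨fun h => ⟨⟨0, by positivity⟩, fun _ => h⟩, fun ⟨_, h⟩ => h ⟨0, hm⟩⟩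
    · refine le_trans ?_ (farFromMonotone_not_apply i h hh)
      gcongr
      linarith
    · refine (bisectionRejectProb_le_one _ T).trans (ENNReal.one_le_ofReal.2 ?_)
      rw [one_le_div hr0]
      have : Real.sqrt n ≤ 8 := by
        rw [Real.sqrt_le_left (by norm_num)]
        have : (n : ℝ) ≤ 64 := by exact_mod_cast (not_le.1 hn64).le
        linarith
      have h4 : 0 < 4 / c := by positivity
      linarith
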